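/- For a class $\mathcal{F}$ of functions $\mathcal{X}\to\mathbb{R}$ and $m\ge 1$, the Rademacher complexity of $\mathcal F$ on $m$ inputs from $\mathcal X$ is $$R_m(\mathcal{F})=\sup_{x_1,\dots,x_m\in\mathcal{X}}\ \mathbb{E}_{\sigma}\Big[\sup_{f\in\mathcal{F}}\frac1m\sum_{i=1}^m\sigma_i f(x_i)\Big],$$ where $\sigma=(\sigma_1,\dots,\sigma_m)$ is uniformly distributed on $\{-1,+1\}^m$. All vector norms are Euclidean. **Theorem.** There is a universal constant $c>0$ such that the following holds for all real $L,B\ge 1$, $0<\epsilon\le 1$ (so that $LB/\epsilon\ge 1$), $a\in\mathbb{R}$ and all $n,d\in\mathbb{N}$. Let $\Psi_{L,a,n}$ be the class of all $L$-Lipschitz functions $\psi:\{z\in\mathbb{R}^n:\|z\|\le B\}\to\mathbb{R}$ with $\psi(0)=a$, and let $\mathcal{W}_{B,n}$ be the class of all linear maps $x\mapsto Wx$ on $\{x\in\mathbb{R}^d:\|x\|\le 1\}$, where $W\in\mathbb{R}^{n\times d}$ has Frobenius norm $\|W\|_F\le B$. Then, for every integer $m\ge 3$ with $$m\ \ge\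 \Big(\frac{LB}{\epsilon}\Big)^{cL^2B^2/\epsilon^2},$$ the Rademacher complexity of $\Psi_{L,a,n}\circ\mathcal{W}_{B,n}=\{\psi\circ g:\psi\in\Psi_{L,a,n},\ g\in\mathcal{W}_{B,n}\}$ on $m$ inputs from $\{x\in\mathbb{R}^d:\|x\|\le 1\}$ is at most $\epsilon$. -/

import Mathlib

open Metric
open scoped NNReal Matrix.Norms.Frobenius

/-- The Rademacher complexity `R_m(F)` of a class `F` of real functions on a domain `X`:
the supremum over `x₁, …, x_m ∈ X` of the expectation, over uniformly random signs
`σ ∈ {-1, 1}^m`, of `sup_{f ∈ F} (1/m) ∑ i, σ_i f(x_i)`.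
It takes values in the extended reals, so an unbounded supremum is `⊤`. -/
noncomputable def rademacherComplexity {X : Type*} (F : Set (X → ℝ)) (m : ℕ) : EReal :=
  ⨆ x : Fin m → X,
    (∑ σ : Fin m → ℤˣ,
      ⨆ f ∈ F, (((1 / (m : ℝ)) * ∑ i, ((σ i : ℤ) : ℝ) * f (x i) : ℝ) : EReal)) /
      ((2 ^ m : ℝ) : EReal)

/-- The `L`-Lipschitz functions on the closed Euclidean ball of radius `B` in `ℝⁿ` that equal `a`
at the origin. Such a function is represented by a total function, of which only the
restriction to the ball matters. -/
def lipschitzClass (L : ℝ≥0) (B a : ℝ) (n : ℕ) : Set (EuclideanSpace ℝ (Fin n) → ℝ) :=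
  {ψ | LipschitzOnWith L ψ (closedBall 0 B) ∧ ψ 0 = a}

/-- The maps `x ↦ W x` on the closed Euclidean unit ball of `ℝᵈ`, where `W` is an `n × d` matrix
with Frobenius norm at most `B`. (Matrix norms are Frobenius norms here.) -/
def linearClass (B : ℝ) (n d : ℕ) :
    Set (closedBall (0 : EuclideanSpace ℝ (Fin d)) 1 → EuclideanSpace ℝ (Fin n)) :=
  {g | ∃ W : Matrix (Fin n) (Fin d) ℝ, ‖W‖ ≤ B ∧ g = fun x => Matrix.toEuclideanLin W x.1}

/-- All compositions `ψ ∘ g` with `ψ` in `Psi` and `g` in `G`. -/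
def compositionClass {X Y : Type*} (Psi : Set (Y → ℝ)) (G : Set (X → Y)) : Set (X → ℝ) :=
  {h | ∃ ψ ∈ Psi, ∃ g ∈ G, h = ψ ∘ g}

/-- The linear maps above take values in the ball of radius `B`, so that a composition with a
member of `lipschitzClass` only uses its values on that ball. -/
theorem mem_closedBall_of_mem_linearClass {B : ℝ} {n d : ℕ}
    {g : closedBall (0 : EuclideanSpace ℝ (Fin d)) 1 → EuclideanSpace ℝ (Fin n)}
    (hg : g ∈ linearClass B n d) (x : closedBall (0 : EuclideanSpace ℝ (Fin d)) 1) :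
    g x ∈ closedBall (0 : EuclideanSpace ℝ (Fin n)) B := by
  obtain ⟨W, hW, rfl⟩ := hg
  have hx : ‖(x : EuclideanSpace ℝ (Fin d))‖ ≤ 1 := mem_closedBall_zero_iff.mp x.2
  have h0 : 0 ≤ ‖W‖ := norm_nonneg W
  rw [mem_closedBall_zero_iff]
  have key : ‖Matrix.toEuclideanLin W x.1‖ ≤ ‖W‖ * ‖(x : EuclideanSpace ℝ (Fin d))‖ := by
    rw [EuclideanSpace.norm_eq, EuclideanSpace.norm_eq, Matrix.frobenius_norm_def,
      ← Real.sqrt_eq_rpow, ← Real.sqrt_mul (by positivity)]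
    apply Real.sqrt_le_sqrt
    rw [Finset.sum_mul]
    refine Finset.sum_le_sum fun i _ => ?_
    have := Finset.sum_mul_sq_le_sq_mul_sq Finset.univ (fun j => W i j) (fun j => x.1 j)
    simpa [Matrix.toEuclideanLin, Matrix.mulVec, dotProduct] using this
  nlinarith

/-! Put `M = L * B` and `r = M / ε`. After subtracting `a`, whose contribution averages out over the
signs, increments of `ψ ∘ W` are bounded by those of a linear map of Hilbert-Schmidt norm at most
`M`. At most `16 * r ^ 2` orthonormal directions carry energy `m / (16 * r ^ 2)` of the sample.
Because the norm is Hilbert-Schmidt, the energy bound on the complement sums over rows, so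
projecting onto these few directions costs `ε * m / 4` in total, whatever `n` and `d` are
(`FrobeniusLipschitz.sum_abs_sub_component_le`). Rounding to a grid costs another `ε * m / 4`, and
the remaining signed sums over cells have square-root size, small once `m` far exceeds the number of
cells (`exists_dominating_of_grid`).

For `r` near 1 the size condition on `m` is too weak for this, and the trivial bound `M` must be
improved by a constant factor. Two antipodal points can attain `M`; three points cannot
(`exists_dominating_triple`). -/

/-- A real majorant `b σ` of each supremum replaces arithmetic in `EReal` by finite real sums. -/
theorem rademacherComplexity_le_of_dominated {X : Type*} {F : Set (X → ℝ)} {m : ℕ} {ε : ℝ}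
    (h : ∀ x : Fin m → X, ∃ b : (Fin m → ℤˣ) → ℝ,
      (∀ σ, ∀ f ∈ F, (1 / (m : ℝ)) * ∑ i, ((σ i : ℤ) : ℝ) * f (x i) ≤ b σ) ∧
      ∑ σ, b σ ≤ 2 ^ m * ε) :
    rademacherComplexity F m ≤ (ε : EReal) := by
  refine iSup_le fun x => ?_
  obtain ⟨b, hb, hsum⟩ := h x
  have hpos : (0 : ℝ) < 2 ^ m := by positivity
  calc _ ≤ (∑ σ, (b σ : EReal)) / ((2 ^ m : ℝ) : EReal) := by
        apply EReal.div_le_div_right_of_nonneg (by exact_mod_cast hpos.le)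
        exact Finset.sum_le_sum fun σ _ => iSup₂_le fun f hf =>
          EReal.coe_le_coe_iff.2 (hb σ f hf)
    _ = (((∑ σ, b σ) / 2 ^ m : ℝ) : EReal) := by
        rw [EReal.coe_div]
        congr 1
        exact (map_sum (⟨⟨Real.toEReal, EReal.coe_zero⟩, EReal.coe_add⟩ : ℝ →+ EReal) b _).symm
    _ ≤ ε := by
        rw [EReal.coe_le_coe_iff, div_le_iff₀ hpos]
        linarith

theorem sum_sign {m : ℕ} (i : Fin m) : ∑ σ : Fin m → ℤˣ, ((σ i : ℤ) : ℝ) = 0 := by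
  have h := Equiv.sum_comp (Equiv.mulLeft (Pi.mulSingle i (-1) : Fin m → ℤˣ))
    (fun σ => ((σ i : ℤ) : ℝ))
  simp at h
  linarith

theorem sum_sign_mul_sign_of_ne {m : ℕ} {i j : Fin m} (hij : i ≠ j) :
    ∑ σ : Fin m → ℤˣ, ((σ i : ℤ) : ℝ) * ((σ j : ℤ) : ℝ) = 0 := by
  have h := Equiv.sum_comp (Equiv.mulLeft (Pi.mulSingle i (-1) : Fin m → ℤˣ))
    (fun σ => ((σ i : ℤ) : ℝ) * ((σ j : ℤ) : ℝ))
  simp [Pi.mulSingle_eq_of_ne hij.symm] at h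
  linarith

theorem sign_mul_sign_self (u : ℤˣ) : ((u : ℤ) : ℝ) * ((u : ℤ) : ℝ) = 1 := by
  rcases Int.units_eq_one_or u with rfl | rfl <;> norm_num

theorem abs_sign (u : ℤˣ) : |((u : ℤ) : ℝ)| = 1 := by
  rcases Int.units_eq_one_or u with rfl | rfl <;> norm_num

theorem sum_sq_sum_sign {m : ℕ} (s : Finset (Fin m)) :
    ∑ σ : Fin m → ℤˣ, (∑ i ∈ s, ((σ i : ℤ) : ℝ)) ^ 2 = 2 ^ m * (s.card : ℝ) := by
  simp_rw [pow_two, Finset.sum_mul_sum]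
  rw [Finset.sum_comm]
  have : ∀ i ∈ s, ∑ σ : Fin m → ℤˣ, ∑ j ∈ s, ((σ i : ℤ) : ℝ) * ((σ j : ℤ) : ℝ) = 2 ^ m := by
    intro i hi
    rw [Finset.sum_comm, Finset.sum_eq_single i]
    · rw [Finset.sum_congr rfl fun σ _ => sign_mul_sign_self (σ i)]
      simp
    · intro j _ hj
      exact sum_sign_mul_sign_of_ne hj.symm
    · exact fun h => absurd hi h
  rw [Finset.sum_congr rfl this]
  simp [mul_comm]

/-! ### High-energy directions and projection onto them -/

section Hilbert

variable {E : Type*} [NormedAddCommGroup E] [InnerProductSpace ℝ E]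

/-- Greedy selection of the directions in which the points `x i` carry much energy. -/
theorem exists_orthonormal_sum_inner_sq_le {m : ℕ} (x : Fin m → E) (hx : ∀ i, ‖x i‖ ≤ 1)
    {t : ℝ} (ht : 0 < t) :
    ∃ (k : ℕ) (v : Fin k → E), Orthonormal ℝ v ∧ k * t ≤ m ∧
      ∀ w, (∀ j, inner ℝ (v j) w = 0) → ∑ i, inner ℝ (x i) w ^ 2 ≤ t * ‖w‖ ^ 2 := by
  -- By Bessel, the energies along an orthonormal family add up to at most `m`.
  have bound : ∀ (k : ℕ) (v : Fin k → E), Orthonormal ℝ v →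
      (∀ j, t ≤ ∑ i, inner ℝ (x i) (v j) ^ 2) → k * t ≤ m := by
    intro k v hv h
    calc (k : ℝ) * t = ∑ _j : Fin k, t := by simp
      _ ≤ ∑ j, ∑ i, inner ℝ (x i) (v j) ^ 2 := Finset.sum_le_sum fun j _ => h j
      _ = ∑ i, ∑ j, inner ℝ (x i) (v j) ^ 2 := Finset.sum_comm
      _ ≤ ∑ _i : Fin m, 1 := by
        refine Finset.sum_le_sum fun i _ => ?_
        have h1 := hv.sum_inner_products_le (x i) (s := Finset.univ)
        have h2 : ‖x i‖ ^ 2 ≤ 1 := pow_le_one₀ (norm_nonneg _) (hx i)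
        simp only [Real.norm_eq_abs, sq_abs, real_inner_comm] at h1 ⊢
        linarith
      _ = m := by simp
  -- Otherwise every such family extends by a normalized violating `w`, so `k` is unbounded, against
  -- `bound`.
  by_contra! hcon
  have all : ∀ k : ℕ, ∃ v : Fin k → E, Orthonormal ℝ v ∧
      ∀ j, t ≤ ∑ i, inner ℝ (x i) (v j) ^ 2 := by
    intro k
    induction k with
    | zero => exact ⟨Fin.elim0, ⟨fun j => j.elim0, fun j => j.elim0⟩, fun j => j.elim0⟩
    | succ k ih =>
      obtain ⟨v, hv, hvt⟩ := ih
      obtain ⟨w, hw, hlt⟩ := hcon k v hv (bound k v hv hvt)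
      have hw0 : w ≠ 0 := by
        rintro rfl
        simp at hlt
      have hn : 0 < ‖w‖ := norm_pos_iff.2 hw0
      refine ⟨Fin.snoc v (‖w‖⁻¹ • w), ?_, ?_⟩
      · refine ⟨fun j => ?_, fun j => ?_⟩
        · refine Fin.lastCases ?_ (fun j => ?_) j
          · simp [norm_smul, hn.ne']
          · simpa using hv.1 j
        · refine Fin.lastCases ?_ (fun j => ?_) j
          · intro l
            refine Fin.lastCases (fun h => absurd rfl h) (fun l _ => ?_) l
            simp [inner_smul_left, real_inner_comm (v l) w, hw l]
          · intro l
            refine Fin.lastCases (fun _ => ?_) (fun l h => ?_) l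
            · simp [inner_smul_right, hw j]
            · simpa using hv.2 (fun h' => h (by rw [h']))
      · refine fun j => Fin.lastCases ?_ (fun j => ?_) j
        · simp only [Fin.snoc_last, inner_smul_right, mul_pow, ← Finset.mul_sum]
          rw [inv_pow, ← div_eq_inv_mul, le_div_iff₀ (by positivity)]
          exact hlt.le
        · simpa using hvt j
  obtain ⟨k, hk⟩ := exists_nat_gt ((m : ℝ) / t)
  obtain ⟨v, hv, hvt⟩ := all k
  have := bound k v hv hvt
  rw [div_lt_iff₀ ht] at hk
  linarith

/-- The component of `z` in the span of the orthonormal family `v`. -/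
noncomputable def component {k : ℕ} (v : Fin k → E) (z : E) : E := ∑ j, inner ℝ (v j) z • v j

theorem inner_component {k : ℕ} {v : Fin k → E} (hv : Orthonormal ℝ v) (z : E) (j : Fin k) :
    inner ℝ (v j) (component v z) = inner ℝ (v j) z :=
  hv.inner_right_fintype _ j

theorem component_sub {k : ℕ} (v : Fin k → E) (y z : E) :
    component v (y - z) = component v y - component v z := by
  simp [component, inner_sub_right, sub_smul]

theorem norm_component_sq {k : ℕ} {v : Fin k → E} (hv : Orthonormal ℝ v) (z : E) :
    ‖component v z‖ ^ 2 = ∑ j, inner ℝ (v j) z ^ 2 := by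
  rw [← real_inner_self_eq_norm_sq]
  nth_rewrite 1 [component]
  simp [sum_inner, inner_smul_left, inner_component hv, pow_two]

theorem inner_component_comm {k : ℕ} (v : Fin k → E) (y z : E) :
    inner ℝ (component v y) z = inner ℝ y (component v z) := by
  simp only [component, sum_inner, inner_sum, inner_smul_left, inner_smul_right]
  refine Finset.sum_congr rfl fun j _ => ?_
  rw [real_inner_comm y (v j)]
  simp [mul_comm]

theorem norm_component_le {k : ℕ} {v : Fin k → E} (hv : Orthonormal ℝ v) (z : E) :
    ‖component v z‖ ≤ ‖z‖ := by
  have h := hv.sum_inner_products_le z (s := Finset.univ)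
  simp only [Real.norm_eq_abs, sq_abs] at h
  rw [← norm_component_sq hv] at h
  exact le_of_sq_le_sq h (norm_nonneg _)

theorem norm_sub_component_sq_le {k : ℕ} {v : Fin k → E} (hv : Orthonormal ℝ v) (z : E) :
    ‖z - component v z‖ ^ 2 ≤ ‖z‖ ^ 2 := by
  have h : inner ℝ z (component v z) = ‖component v z‖ ^ 2 := by
    rw [norm_component_sq hv, component, inner_sum]
    refine Finset.sum_congr rfl fun j _ => ?_
    rw [inner_smul_right, real_inner_comm z, pow_two]
  rw [norm_sub_sq_real, h]
  nlinarith [sq_nonneg ‖component v z‖]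

/-- The projection is self-adjoint, so it can be moved from `x i` to `w`, where `h` applies. -/
theorem sum_inner_sub_component_sq_le {m k : ℕ} {x : Fin m → E} {v : Fin k → E} {t : ℝ}
    (hv : Orthonormal ℝ v) (ht : 0 ≤ t)
    (h : ∀ w, (∀ j, inner ℝ (v j) w = 0) → ∑ i, inner ℝ (x i) w ^ 2 ≤ t * ‖w‖ ^ 2) (w : E) :
    ∑ i, inner ℝ w (x i - component v (x i)) ^ 2 ≤ t * ‖w‖ ^ 2 := by
  have h1 := h (w - component v w) fun j => by rw [inner_sub_right, inner_component hv, sub_self]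
  have h2 : ∀ i, inner ℝ w (x i - component v (x i)) = inner ℝ (x i) (w - component v w) := by
    intro i
    rw [inner_sub_right, inner_sub_right, ← inner_component_comm, real_inner_comm (x i) w,
      real_inner_comm (x i) (component v w)]
  simp_rw [h2]
  exact h1.trans (mul_le_mul_of_nonneg_left (norm_sub_component_sq_le hv w) ht)

/-! ### Grid discretization and the function class -/

/-- Points in the same grid cell of side `1 / N` have components at distance `√k / N`. -/
theorem norm_component_sub_le {k N : ℕ} (hN : 0 < N) {v : Fin k → E} (hv : Orthonormal ℝ v)
    {y z : E} (h : ∀ j, ⌊(N : ℝ) * inner ℝ (v j) y⌋ = ⌊(N : ℝ) * inner ℝ (v j) z⌋) :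
    ‖component v y - component v z‖ ^ 2 ≤ k / (N : ℝ) ^ 2 := by
  have hN' : (0 : ℝ) < N := by exact_mod_cast hN
  rw [← component_sub, norm_component_sq hv]
  calc ∑ j, inner ℝ (v j) (y - z) ^ 2 ≤ ∑ _j : Fin k, 1 / (N : ℝ) ^ 2 := by
        refine Finset.sum_le_sum fun j _ => ?_
        have h1 := Int.abs_sub_lt_one_of_floor_eq_floor (h j)
        rw [← mul_sub, ← inner_sub_right] at h1
        rw [le_div_iff₀ (by positivity), ← mul_pow, mul_comm, ← sq_abs]
        exact pow_le_one₀ (abs_nonneg _) h1.le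
    _ = k / (N : ℝ) ^ 2 := by simp [div_eq_mul_inv]

theorem card_image_floor_le {m k N : ℕ} {v : Fin k → E} (hv : Orthonormal ℝ v) {x : Fin m → E}
    (hx : ∀ i, ‖x i‖ ≤ 1) :
    (Finset.univ.image fun (i : Fin m) (j : Fin k) => ⌊(N : ℝ) * inner ℝ (v j) (x i)⌋).card ≤
      (2 * N + 1) ^ k := by
  calc _ ≤ (Fintype.piFinset fun _ : Fin k => Finset.Icc (-(N : ℤ)) N).card := by
        refine Finset.card_le_card ?_
        intro c hc
        obtain ⟨i, -, rfl⟩ := Finset.mem_image.1 hc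
        refine Fintype.mem_piFinset.2 fun j => ?_
        have h1 : |inner ℝ (v j) (x i)| ≤ 1 :=
          (abs_real_inner_le_norm _ _).trans (by rw [hv.1 j, one_mul]; exact hx i)
        obtain ⟨h2, h3⟩ := abs_le.1 h1
        have hN : (0 : ℝ) ≤ N := N.cast_nonneg
        refine Finset.mem_Icc.2 ⟨Int.le_floor.2 ?_, ?_⟩
        · push_cast
          nlinarith
        · have : ((⌊(N : ℝ) * inner ℝ (v j) (x i)⌋ : ℤ) : ℝ) ≤ ((N : ℤ) : ℝ) :=
            (Int.floor_le _).trans (by push_cast; nlinarith)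
          exact_mod_cast this
    _ = (2 * N + 1) ^ k := by
        rw [Fintype.card_piFinset_const, Int.card_Icc]
        congr 1
        omega

/-- Functions vanishing at the origin whose increments on the unit ball are controlled by a linear
map, with rows `w j`, of Hilbert-Schmidt norm at most `M`. -/
def FrobeniusLipschitz (M : ℝ) (f : E → ℝ) : Prop :=
  f 0 = 0 ∧ ∃ (n : ℕ) (w : Fin n → E), ∑ j, ‖w j‖ ^ 2 ≤ M ^ 2 ∧
    ∀ y z, ‖y‖ ≤ 1 → ‖z‖ ≤ 1 → (f y - f z) ^ 2 ≤ ∑ j, inner ℝ (w j) (y - z) ^ 2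

theorem FrobeniusLipschitz.abs_sub_le {M : ℝ} {f : E → ℝ} (hf : FrobeniusLipschitz M f)
    (hM : 0 ≤ M) {y z : E} (hy : ‖y‖ ≤ 1) (hz : ‖z‖ ≤ 1) : |f y - f z| ≤ M * ‖y - z‖ := by
  obtain ⟨-, n, w, hw, hfw⟩ := hf
  refine abs_le_of_sq_le_sq ?_ (by positivity)
  calc (f y - f z) ^ 2 ≤ ∑ j, inner ℝ (w j) (y - z) ^ 2 := hfw y z hy hz
    _ ≤ ∑ j, ‖w j‖ ^ 2 * ‖y - z‖ ^ 2 := by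
        refine Finset.sum_le_sum fun j _ => ?_
        rw [← mul_pow, ← sq_abs]
        exact pow_le_pow_left₀ (abs_nonneg _) (abs_real_inner_le_norm _ _) 2
    _ ≤ (M * ‖y - z‖) ^ 2 := by
        rw [← Finset.sum_mul, mul_pow]
        exact mul_le_mul_of_nonneg_right hw (by positivity)

theorem FrobeniusLipschitz.abs_le {M : ℝ} {f : E → ℝ} (hf : FrobeniusLipschitz M f)
    (hM : 0 ≤ M) {y : E} (hy : ‖y‖ ≤ 1) : |f y| ≤ M := by
  have h := hf.abs_sub_le hM hy (z := 0) (by simp)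
  rw [hf.1, sub_zero, sub_zero] at h
  exact h.trans (mul_le_of_le_one_right hM hy)

/-- Exchanging the sums over points and rows lets the energy bound act on each row separately;
Cauchy-Schwarz over the points then passes from squares to absolute values. -/
theorem FrobeniusLipschitz.sum_abs_sub_component_le {M r : ℝ} {f : E → ℝ}
    (hf : FrobeniusLipschitz M f) (hM : 0 ≤ M) (hr : 0 < r) {m k : ℕ} {x : Fin m → E}
    (hx : ∀ i, ‖x i‖ ≤ 1) {v : Fin k → E} (hv : Orthonormal ℝ v)
    (h : ∀ w, (∀ j, inner ℝ (v j) w = 0) →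
      ∑ i, inner ℝ (x i) w ^ 2 ≤ m / (16 * r ^ 2) * ‖w‖ ^ 2) :
    ∑ i, |f (x i) - f (component v (x i))| ≤ M * (m / (4 * r)) := by
  obtain ⟨-, n, w, hw, hfw⟩ := hf
  refine le_of_sq_le_sq ?_ (by positivity)
  have key : ∑ i, |f (x i) - f (component v (x i))| ^ 2 ≤ m / (16 * r ^ 2) * M ^ 2 :=
    calc _ ≤ ∑ i, ∑ j, inner ℝ (w j) (x i - component v (x i)) ^ 2 := by
          refine Finset.sum_le_sum fun i _ => ?_
          rw [sq_abs]
          exact hfw _ _ (hx i) ((norm_component_le hv _).trans (hx i))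
      _ = ∑ j, ∑ i, inner ℝ (w j) (x i - component v (x i)) ^ 2 := Finset.sum_comm
      _ ≤ ∑ j, m / (16 * r ^ 2) * ‖w j‖ ^ 2 := Finset.sum_le_sum fun j _ =>
          sum_inner_sub_component_sq_le hv (by positivity) h (w j)
      _ ≤ m / (16 * r ^ 2) * M ^ 2 := by
          rw [← Finset.mul_sum]
          exact mul_le_mul_of_nonneg_left hw (by positivity)
  calc _ ≤ (m : ℝ) * ∑ i, |f (x i) - f (component v (x i))| ^ 2 := by
        simpa using sq_sum_le_card_mul_sum_sq (s := Finset.univ)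
          (f := fun i => |f (x i) - f (component v (x i))|)
    _ ≤ m * (m / (16 * r ^ 2) * M ^ 2) := mul_le_mul_of_nonneg_left key (by positivity)
    _ = (M * (m / (4 * r))) ^ 2 := by field_simp; ring

/-- The signed sums are dominated after projecting onto the high-energy directions and
discretizing with a grid. -/
theorem exists_dominating_of_grid {M r : ℝ} (hM : 0 ≤ M) (hr : 1 ≤ r) {m N : ℕ} (hm : 0 < m)
    (hN : 16 * r ^ 2 ≤ N) {x : Fin m → E} (hx : ∀ i, ‖x i‖ ≤ 1) :
    ∃ b : (Fin m → ℤˣ) → ℝ,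
      (∀ σ, ∀ f : E → ℝ, FrobeniusLipschitz M f → ∑ i, ((σ i : ℤ) : ℝ) * f (x i) ≤ b σ) ∧
      ∃ k : ℕ, (k : ℝ) ≤ 16 * r ^ 2 ∧
      ∑ σ, b σ ≤ 2 ^ m * (M * (5 * (m / (8 * r)) + 2 * r * (2 * N + 1) ^ k)) := by
  have hr0 : 0 < r := by linarith
  have hm' : (0 : ℝ) < m := by exact_mod_cast hm
  have hN0 : (0 : ℝ) < N := by nlinarith
  have : Nonempty (Fin m) := ⟨⟨0, hm⟩⟩
  obtain ⟨k, v, hv, hk, hvx⟩ :=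
    exists_orthonormal_sum_inner_sq_le x hx (t := m / (16 * r ^ 2)) (by positivity)
  have hk' : (k : ℝ) ≤ 16 * r ^ 2 := by
    rw [← mul_div_assoc, div_le_iff₀ (by positivity), mul_comm] at hk
    exact le_of_mul_le_mul_left hk hm'
  set cell : Fin m → Fin k → ℤ := fun i j => ⌊(N : ℝ) * inner ℝ (v j) (x i)⌋ with hcell
  set C := Finset.univ.image cell with hC
  have hcard : (C.card : ℝ) ≤ (2 * N + 1) ^ k := by
    exact_mod_cast card_image_floor_le (N := N) hv hx
  set S : (Fin m → ℤˣ) → (Fin k → ℤ) → ℝ :=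
    fun σ c => ∑ i with cell i = c, ((σ i : ℤ) : ℝ) with hS
  have hP : ∀ i, ‖component v (x i)‖ ≤ 1 := fun i => (norm_component_le hv _).trans (hx i)
  -- The terms account for projection, rounding to the grid, and the signed sums over cells.
  refine ⟨fun σ => M * (m / (4 * r) + m / (4 * r) +
    ∑ c ∈ C, (4 * r + S σ c ^ 2 / (4 * r)) / 2), fun σ f hf => ?_, k, hk', ?_⟩
  · set g : (Fin k → ℤ) → ℝ := fun c => f (component v (x (Function.invFun cell c))) with hg
    have h1 : ∀ i, ((σ i : ℤ) : ℝ) * f (x i) ≤ |f (x i) - f (component v (x i))| +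
        M * (1 / (4 * r)) + ((σ i : ℤ) : ℝ) * g (cell i) := by
      intro i
      have hrep : cell (Function.invFun cell (cell i)) = cell i :=
        Function.invFun_eq ⟨i, rfl⟩
      have hclose : ‖component v (x i) - component v (x (Function.invFun cell (cell i)))‖ ≤
          1 / (4 * r) := by
        -- Here `k / N ^ 2 ≤ 16 * r ^ 2 / (16 * r ^ 2) ^ 2 = (1 / (4 * r)) ^ 2`.
        refine le_of_sq_le_sq ((norm_component_sub_le (N := N) (by exact_mod_cast hN0) hv
          fun j => (congrFun hrep j).symm).trans ?_) (by positivity)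
        rw [div_pow, one_pow, div_le_div_iff₀ (by positivity) (by positivity)]
        nlinarith
      have hlip := hf.abs_sub_le hM (hP i) (hP (Function.invFun cell (cell i)))
      have hlip' := hlip.trans (mul_le_mul_of_nonneg_left hclose hM)
      have htri : |f (x i) - g (cell i)| ≤
          |f (x i) - f (component v (x i))| + M * (1 / (4 * r)) :=
        (abs_sub_le _ (f (component v (x i))) _).trans (by linarith)
      have hsgn : ((σ i : ℤ) : ℝ) * (f (x i) - g (cell i)) ≤ |f (x i) - g (cell i)| := by
        refine (le_abs_self _).trans ?_
        rw [abs_mul, abs_sign, one_mul]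
      linarith
    have h2 : ∑ i, ((σ i : ℤ) : ℝ) * g (cell i) = ∑ c ∈ C, S σ c * g c := by
      rw [← Finset.sum_fiberwise_of_maps_to (g := cell) (t := C)
        fun i hi => Finset.mem_image_of_mem cell hi]
      refine Finset.sum_congr rfl fun c _ => ?_
      rw [hS, Finset.sum_mul]
      refine Finset.sum_congr rfl fun i hi => ?_
      rw [(Finset.mem_filter.1 hi).2]
    have h3 : ∀ c ∈ C, S σ c * g c ≤ M * ((4 * r + S σ c ^ 2 / (4 * r)) / 2) := by
      intro c _
      -- AM-GM makes the bound quadratic in `S σ c`, so that its average over `σ` is computed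
      -- exactly.
      have h4 : |S σ c| ≤ (4 * r + S σ c ^ 2 / (4 * r)) / 2 := by
        have h5 : (4 * r + S σ c ^ 2 / (4 * r)) / 2 - |S σ c| =
            (4 * r - |S σ c|) ^ 2 / (8 * r) := by
          rw [← sq_abs (S σ c)]
          field_simp
          ring
        have h6 : 0 ≤ (4 * r - |S σ c|) ^ 2 / (8 * r) := by positivity
        linarith
      calc S σ c * g c ≤ |S σ c| * |g c| := by rw [← abs_mul]; exact le_abs_self _
        _ ≤ |S σ c| * M := mul_le_mul_of_nonneg_left (hf.abs_le hM (hP _)) (abs_nonneg _)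
        _ ≤ _ := by rw [mul_comm]; exact mul_le_mul_of_nonneg_left h4 hM
    calc ∑ i, ((σ i : ℤ) : ℝ) * f (x i)
        ≤ ∑ i, (|f (x i) - f (component v (x i))| + M * (1 / (4 * r)) +
            ((σ i : ℤ) : ℝ) * g (cell i)) := Finset.sum_le_sum fun i _ => h1 i
      _ = ∑ i, |f (x i) - f (component v (x i))| + M * (m / (4 * r)) + ∑ c ∈ C, S σ c * g c := by
          rw [Finset.sum_add_distrib, Finset.sum_add_distrib, h2]
          simp only [Finset.sum_const, Finset.card_univ, Fintype.card_fin, nsmul_eq_mul]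
          ring
      _ ≤ M * (m / (4 * r)) + M * (m / (4 * r)) +
            ∑ c ∈ C, M * ((4 * r + S σ c ^ 2 / (4 * r)) / 2) := by
          have := hf.sum_abs_sub_component_le hM hr0 hx hv hvx
          have := Finset.sum_le_sum h3
          linarith
      _ = _ := by rw [← Finset.mul_sum]; ring
  · have h1 : ∑ σ, ∑ c ∈ C, S σ c ^ 2 = 2 ^ m * m := by
      rw [Finset.sum_comm]
      simp_rw [hS, sum_sq_sum_sign, ← Finset.mul_sum]
      congr 1
      have := Finset.card_eq_sum_card_image cell Finset.univ
      rw [Finset.card_univ, Fintype.card_fin] at this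
      exact_mod_cast this.symm
    have h2 : ∀ σ, ∑ c ∈ C, (4 * r + S σ c ^ 2 / (4 * r)) / 2 =
        2 * r * C.card + (∑ c ∈ C, S σ c ^ 2) / (8 * r) := by
      intro σ
      rw [Finset.sum_div, mul_comm (2 * r), ← nsmul_eq_mul, ← Finset.sum_const, ← Finset.sum_add_distrib]
      refine Finset.sum_congr rfl fun c _ => ?_
      field_simp
      ring
    calc _ = 2 ^ m * (M * (5 * (m / (8 * r)) + 2 * r * C.card)) := by
          simp_rw [h2]
          rw [← Finset.mul_sum, Finset.sum_add_distrib, Finset.sum_add_distrib,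
            Finset.sum_add_distrib, ← Finset.sum_div (f := fun σ => ∑ c ∈ C, S σ c ^ 2), h1]
          simp only [Finset.sum_const, Finset.card_univ, Fintype.card_pi, Finset.prod_const,
            Fintype.card_units_int, Fintype.card_fin, nsmul_eq_mul]
          push_cast
          field_simp
          ring
      _ ≤ _ := by gcongr

/-! ### A constant-factor gain from three points -/

/-- The Gram matrix of `y` and `z` has norm at most `1 + |⟨y, z⟩|`, which bounds each row's
contribution. Nearly orthogonal points thus cannot both have values near `M`. -/
theorem FrobeniusLipschitz.sq_add_sq_le {M : ℝ} {f : E → ℝ} (hf : FrobeniusLipschitz M f)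
    {y z : E} (hy : ‖y‖ ≤ 1) (hz : ‖z‖ ≤ 1) :
    f y ^ 2 + f z ^ 2 ≤ M ^ 2 * (1 + |inner ℝ y z|) := by
  obtain ⟨hf0, n, w, hw, hfw⟩ := hf
  have bessel : ∀ u : E, inner ℝ u y ^ 2 + inner ℝ u z ^ 2 ≤ ‖u‖ ^ 2 * (1 + |inner ℝ y z|) := by
    intro u
    set α := inner ℝ u y with hα
    set β := inner ℝ u z with hβ
    have h1 : α ^ 2 + β ^ 2 = inner ℝ u (α • y + β • z) := by
      rw [inner_add_right, inner_smul_right, inner_smul_right]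
      ring
    have h2 : ‖α • y + β • z‖ ^ 2 ≤ (α ^ 2 + β ^ 2) * (1 + |inner ℝ y z|) := by
      rw [norm_add_sq_real, norm_smul, norm_smul, inner_smul_left, inner_smul_right, mul_pow,
        mul_pow, Real.norm_eq_abs, Real.norm_eq_abs, sq_abs, sq_abs]
      have h3 : α * (β * inner ℝ y z) ≤ |α| * |β| * |inner ℝ y z| := by
        rw [← abs_mul, ← abs_mul, mul_assoc]
        exact le_abs_self _
      have h4 : 2 * (|α| * |β|) ≤ α ^ 2 + β ^ 2 := by
        nlinarith [sq_nonneg (|α| - |β|), sq_abs α, sq_abs β]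
      have h5 : α ^ 2 * ‖y‖ ^ 2 ≤ α ^ 2 :=
        mul_le_of_le_one_right (sq_nonneg _) (pow_le_one₀ (norm_nonneg _) hy)
      have h6 : β ^ 2 * ‖z‖ ^ 2 ≤ β ^ 2 :=
        mul_le_of_le_one_right (sq_nonneg _) (pow_le_one₀ (norm_nonneg _) hz)
      have h7 := mul_le_mul_of_nonneg_right h4 (abs_nonneg (inner ℝ y z))
      simp only [conj_trivial]
      linarith
    have h3 : (α ^ 2 + β ^ 2) ^ 2 ≤ ‖u‖ ^ 2 * ((α ^ 2 + β ^ 2) * (1 + |inner ℝ y z|)) := by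
      calc (α ^ 2 + β ^ 2) ^ 2 ≤ (‖u‖ * ‖α • y + β • z‖) ^ 2 := by
            refine pow_le_pow_left₀ (by positivity) ?_ 2
            rw [h1]
            exact real_inner_le_norm _ _
        _ ≤ _ := by
            rw [mul_pow]
            exact mul_le_mul_of_nonneg_left h2 (by positivity)
    rcases (show 0 ≤ α ^ 2 + β ^ 2 by positivity).eq_or_lt with h | h
    · rw [← h]
      positivity
    · refine le_of_mul_le_mul_left ?_ h
      linarith
  have h1 := hfw y 0 hy (by simp)
  have h2 := hfw z 0 hz (by simp)
  simp only [hf0, sub_zero] at h1 h2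
  calc f y ^ 2 + f z ^ 2 ≤ ∑ j, (inner ℝ (w j) y ^ 2 + inner ℝ (w j) z ^ 2) := by
        rw [Finset.sum_add_distrib]
        exact add_le_add h1 h2
    _ ≤ ∑ j, ‖w j‖ ^ 2 * (1 + |inner ℝ y z|) := Finset.sum_le_sum fun j _ => bessel (w j)
    _ ≤ _ := by
        rw [← Finset.sum_mul]
        exact mul_le_mul_of_nonneg_right hw (by positivity)

theorem exists_dominating_pair {M : ℝ} (hM : 0 ≤ M) {m : ℕ} {x : Fin m → E}
    (hx : ∀ i, ‖x i‖ ≤ 1) {i j : Fin m} (hij : i ≠ j)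
    (h : -(7 / 8) ≤ (inner ℝ (x i) (x j) : ℝ)) :
    ∃ b : (Fin m → ℤˣ) → ℝ,
      (∀ σ, ∀ f : E → ℝ, FrobeniusLipschitz M f →
        ((σ i : ℤ) : ℝ) * f (x i) + ((σ j : ℤ) : ℝ) * f (x j) ≤ M * b σ) ∧
      ∑ σ, b σ ≤ 2 ^ m * (97 / 50) := by
  rcases le_total (inner ℝ (x i) (x j) : ℝ) (7 / 8) with h' | h'
  -- The sum is at most `M * √(2 * 15 / 8)`, and `(97 / 50) ^ 2 > 15 / 4`.
  · refine ⟨fun _ => 97 / 50, fun σ f hf => ?_, by simp⟩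
    have h1 := hf.sq_add_sq_le (hx i) (hx j)
    have h2 : M ^ 2 * (1 + |inner ℝ (x i) (x j)|) ≤ M ^ 2 * (15 / 8) :=
      mul_le_mul_of_nonneg_left (by linarith [abs_le.2 ⟨h, h'⟩]) (sq_nonneg M)
    refine le_of_sq_le_sq ?_ (by positivity)
    have hi := sign_mul_sign_self (σ i)
    have hj := sign_mul_sign_self (σ j)
    have h3 : (((σ i : ℤ) : ℝ) * f (x i) + ((σ j : ℤ) : ℝ) * f (x j)) ^ 2 ≤
        2 * ((((σ i : ℤ) : ℝ) * ((σ i : ℤ) : ℝ)) * f (x i) ^ 2 +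
          (((σ j : ℤ) : ℝ) * ((σ j : ℤ) : ℝ)) * f (x j) ^ 2) := by
      linarith [sq_nonneg (((σ i : ℤ) : ℝ) * f (x i) - ((σ j : ℤ) : ℝ) * f (x j))]
    rw [hi, hj] at h3
    linarith [sq_nonneg M]
  -- This is 2 for equal signs and 1/2 for opposite ones, where `‖x i - x j‖ ≤ 1 / 2` forces
  -- cancellation.
  · refine ⟨fun σ => 5 / 4 + 3 / 4 * (((σ i : ℤ) : ℝ) * ((σ j : ℤ) : ℝ)),
      fun σ f hf => ?_, ?_⟩
    · have hclose : ‖x i - x j‖ ≤ 1 / 2 := by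
        refine le_of_sq_le_sq ?_ (by norm_num)
        rw [norm_sub_sq_real]
        have := pow_le_one₀ (norm_nonneg _) (hx i) (n := 2)
        have := pow_le_one₀ (norm_nonneg _) (hx j) (n := 2)
        linarith
      have h1 := (hf.abs_sub_le hM (hx i) (hx j)).trans (mul_le_mul_of_nonneg_left hclose hM)
      obtain ⟨h2, h3⟩ := abs_le.1 h1
      obtain ⟨h4, h5⟩ := abs_le.1 (hf.abs_le hM (hx i))
      obtain ⟨h6, h7⟩ := abs_le.1 (hf.abs_le hM (hx j))
      rcases Int.units_eq_one_or (σ i) with hi | hi <;>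
        rcases Int.units_eq_one_or (σ j) with hj | hj <;>
        · simp only [hi, hj]
          push_cast
          linarith
    · rw [Finset.sum_add_distrib, ← Finset.mul_sum, sum_sign_mul_sign_of_ne hij]
      simp only [Finset.sum_const, Finset.card_univ, Fintype.card_pi, Finset.prod_const,
        Fintype.card_units_int, Fintype.card_fin, nsmul_eq_mul]
      push_cast
      linarith [show (0 : ℝ) < 2 ^ m by positivity]

/-- Three vectors of the unit ball cannot be pairwise nearly antipodal; a pair that is not supplies
the gain, and the third point is bounded trivially. -/
theorem exists_dominating_triple {M : ℝ} (hM : 0 ≤ M) {m : ℕ} {x : Fin m → E}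
    (hx : ∀ i, ‖x i‖ ≤ 1) {i j k : Fin m} (hij : i ≠ j) (hjk : j ≠ k) (hik : i ≠ k) :
    ∃ b : (Fin m → ℤˣ) → ℝ,
      (∀ σ, ∀ f : E → ℝ, FrobeniusLipschitz M f →
        ((σ i : ℤ) : ℝ) * f (x i) + ((σ j : ℤ) : ℝ) * f (x j) + ((σ k : ℤ) : ℝ) * f (x k) ≤
          M * b σ) ∧
      ∑ σ, b σ ≤ 2 ^ m * (147 / 50) := by
  have single : ∀ (l : Fin m) (σ : Fin m → ℤˣ) (f : E → ℝ), FrobeniusLipschitz M f →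
      ((σ l : ℤ) : ℝ) * f (x l) ≤ M := by
    intro l σ f hf
    refine (le_abs_self _).trans ?_
    rw [abs_mul, abs_sign, one_mul]
    exact hf.abs_le hM (hx l)
  have extend : ∀ {p q l : Fin m}, p ≠ q → -(7 / 8) ≤ (inner ℝ (x p) (x q) : ℝ) →
      ∃ b : (Fin m → ℤˣ) → ℝ,
      (∀ σ, ∀ f : E → ℝ, FrobeniusLipschitz M f →
        ((σ p : ℤ) : ℝ) * f (x p) + ((σ q : ℤ) : ℝ) * f (x q) + ((σ l : ℤ) : ℝ) * f (x l) ≤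
          M * b σ) ∧
      ∑ σ, b σ ≤ 2 ^ m * (147 / 50) := by
    intro p q l hpq h
    obtain ⟨b, hb, hs⟩ := exists_dominating_pair hM hx hpq h
    refine ⟨fun σ => b σ + 1, fun σ f hf => ?_, ?_⟩
    · linarith [hb σ f hf, single l σ f hf]
    · rw [Finset.sum_add_distrib]
      simp only [Finset.sum_const, Finset.card_univ, Fintype.card_pi, Finset.prod_const,
        Fintype.card_units_int, Fintype.card_fin, nsmul_eq_mul]
      push_cast
      linarith
  by_cases h1 : -(7 / 8) ≤ (inner ℝ (x i) (x j) : ℝ)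
  · exact extend hij h1
  by_cases h2 : -(7 / 8) ≤ (inner ℝ (x j) (x k) : ℝ)
  · obtain ⟨b, hb, hs⟩ := extend (l := i) hjk h2
    exact ⟨b, fun σ f hf => by linarith [hb σ f hf], hs⟩
  by_cases h3 : -(7 / 8) ≤ (inner ℝ (x i) (x k) : ℝ)
  · obtain ⟨b, hb, hs⟩ := extend (l := j) hik h3
    exact ⟨b, fun σ f hf => by linarith [hb σ f hf], hs⟩
  exfalso
  -- This squared norm would be below `3 - 6 * (7 / 8) < 0`.
  have h4 : 0 ≤ ‖x i + x j + x k‖ ^ 2 := by positivity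
  rw [norm_add_sq_real, norm_add_sq_real, inner_add_left] at h4
  have := pow_le_one₀ (norm_nonneg _) (hx i) (n := 2)
  have := pow_le_one₀ (norm_nonneg _) (hx j) (n := 2)
  have := pow_le_one₀ (norm_nonneg _) (hx k) (n := 2)
  linarith

/-- With at least three points the trivial bound `M` improves by an absolute factor. -/
theorem exists_dominating_of_three_le {M : ℝ} (hM : 0 ≤ M) {m : ℕ} (hm : 3 ≤ m) {x : Fin m → E}
    (hx : ∀ i, ‖x i‖ ≤ 1) :
    ∃ b : (Fin m → ℤˣ) → ℝ,
      (∀ σ, ∀ f : E → ℝ, FrobeniusLipschitz M f → ∑ i, ((σ i : ℤ) : ℝ) * f (x i) ≤ b σ) ∧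
      ∑ σ, b σ ≤ 2 ^ m * (49 / 50 * M * m) := by
  obtain ⟨m, rfl⟩ := Nat.exists_eq_add_of_le' hm
  have h01 : ∀ i : Fin (m + 3), i ≠ i + 1 := fun i h => by
    have := congrArg Fin.val (left_eq_add.1 h)
    simp at this
  have h02 : ∀ i : Fin (m + 3), i ≠ i + 2 := fun i h => by
    have := congrArg Fin.val (left_eq_add.1 h)
    simp [Nat.mod_eq_of_lt (show 2 < m + 3 by omega)] at this
  have h12 : ∀ i : Fin (m + 3), i + 1 ≠ i + 2 := fun i h => by
    have := congrArg Fin.val (add_left_cancel h)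
    simp [Nat.mod_eq_of_lt (show 2 < m + 3 by omega)] at this
  choose b hb hs using fun i : Fin (m + 3) =>
    exists_dominating_triple hM hx (h01 i) (h12 i) (h02 i)
  -- Each index lies in three of the cyclic triples `i, i + 1, i + 2`, and `147 / 50 / 3 = 49 / 50`.
  refine ⟨fun σ => M / 3 * ∑ i, b i σ, fun σ f hf => ?_, ?_⟩
  · have h := Finset.sum_le_sum fun (i : Fin (m + 3)) (_ : i ∈ Finset.univ) => hb i σ f hf
    have shift := fun l : Fin (m + 3) =>
      Equiv.sum_comp (Equiv.addRight l) fun i => ((σ i : ℤ) : ℝ) * f (x i)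
    simp only [Equiv.coe_addRight] at shift
    rw [Finset.sum_add_distrib, Finset.sum_add_distrib, shift, shift, ← Finset.mul_sum] at h
    linarith
  · rw [← Finset.mul_sum, Finset.sum_comm]
    have h := Finset.sum_le_sum fun (i : Fin (m + 3)) (_ : i ∈ Finset.univ) => hs i
    simp only [Finset.sum_const, Finset.card_univ, Fintype.card_fin, nsmul_eq_mul] at h
    have := mul_le_mul_of_nonneg_left h (show 0 ≤ M / 3 by positivity)
    linarith

/-! ### Constants and conclusion -/

/-- Since `r ≥ 50 / 49`, constants are absorbed into powers of `r`: both `16 * r ^ 2` and `2 * N +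
1` are at most `35 * r ^ 2 ≤ r ^ 300`. With `k ≤ 16 * r ^ 2` the exponent is `(300 + 16 * 300) * r ^
2`. -/
theorem grid_card_le_rpow {r : ℝ} (hr : 50 / 49 ≤ r) {k N : ℕ} (hk : (k : ℝ) ≤ 16 * r ^ 2)
    (hN : (N : ℝ) ≤ 16 * r ^ 2 + 1) :
    16 * r ^ 2 * (2 * N + 1) ^ k ≤ r ^ (5100 * r ^ 2) := by
  have hr1 : 1 ≤ r := by linarith
  have hr0 : 0 < r := by linarith
  have hr2 : 1 ≤ r ^ 2 := one_le_pow₀ hr1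
  have h35 : 35 * r ^ 2 ≤ r ^ (300 : ℝ) := by
    have h1 : (2 : ℝ) ≤ r ^ 49 :=
      calc (2 : ℝ) ≤ (50 / 49) ^ 49 := by norm_num
        _ ≤ r ^ 49 := pow_le_pow_left₀ (by norm_num) hr 49
    have h2 : (35 : ℝ) ≤ r ^ 298 :=
      calc (35 : ℝ) ≤ 2 ^ 6 := by norm_num
        _ ≤ (r ^ 49) ^ 6 := pow_le_pow_left₀ (by norm_num) h1 6
        _ = r ^ 294 := by rw [← pow_mul]
        _ ≤ r ^ 298 := pow_le_pow_right₀ hr1 (by norm_num)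
    calc 35 * r ^ 2 ≤ r ^ 298 * r ^ 2 := mul_le_mul_of_nonneg_right h2 (by positivity)
      _ = r ^ (300 : ℝ) := by rw [← pow_add, ← Real.rpow_natCast]; norm_num
  have hA : 16 * r ^ 2 ≤ r ^ (300 * r ^ 2) :=
    calc 16 * r ^ 2 ≤ r ^ (300 : ℝ) := by linarith
      _ ≤ _ := Real.rpow_le_rpow_of_exponent_le hr1 (by linarith)
  have hB : (2 * (N : ℝ) + 1) ^ k ≤ r ^ (4800 * r ^ 2) :=
    calc (2 * (N : ℝ) + 1) ^ k ≤ (r ^ (300 : ℝ)) ^ k :=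
          pow_le_pow_left₀ (by positivity) (by linarith) k
      _ = r ^ (300 * (k : ℝ)) := by rw [Real.rpow_mul hr0.le, Real.rpow_natCast]
      _ ≤ _ := Real.rpow_le_rpow_of_exponent_le hr1 (by linarith)
  calc _ ≤ r ^ (300 * r ^ 2) * r ^ (4800 * r ^ 2) :=
        mul_le_mul hA hB (by positivity) (by positivity)
    _ = r ^ (5100 * r ^ 2) := by
        rw [← Real.rpow_add hr0]
        ring_nf

theorem exists_dominating_of_sample_size {M ε : ℝ} (hε : 0 < ε) (hM : 1 ≤ M / ε) {m : ℕ}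
    (hm : 3 ≤ m) (hmM : (M / ε) ^ (5100 * (M / ε) ^ 2) ≤ m) {x : Fin m → E}
    (hx : ∀ i, ‖x i‖ ≤ 1) :
    ∃ b : (Fin m → ℤˣ) → ℝ,
      (∀ σ, ∀ f : E → ℝ, FrobeniusLipschitz M f → ∑ i, ((σ i : ℤ) : ℝ) * f (x i) ≤ b σ) ∧
      ∑ σ, b σ ≤ 2 ^ m * (ε * m) := by
  set r := M / ε with hr
  have hMr : M = ε * r := by rw [hr]; field_simp
  have hr0 : 0 < r := by linarith
  have hM0 : 0 ≤ M := by rw [hMr]; positivity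
  rcases le_total r (50 / 49) with h | h
  · obtain ⟨b, hb, hs⟩ := exists_dominating_of_three_le hM0 hm hx
    refine ⟨b, hb, hs.trans ?_⟩
    have h1 : 49 / 50 * M ≤ ε := by
      rw [hMr]
      nlinarith
    gcongr
  · obtain ⟨b, hb, k, hk, hs⟩ := exists_dominating_of_grid hM0 hM (by omega)
      (Nat.le_ceil (16 * r ^ 2)) hx
    refine ⟨b, hb, hs.trans ?_⟩
    have h1 := (grid_card_le_rpow h hk (Nat.ceil_lt_add_one (by positivity)).le).trans hmM
    have h2 : M * (5 * (m / (8 * r)) + 2 * r * (2 * (⌈16 * r ^ 2⌉₊ : ℝ) + 1) ^ k) =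
        ε * (5 / 8 * m + 1 / 8 * (16 * r ^ 2 * (2 * (⌈16 * r ^ 2⌉₊ : ℝ) + 1) ^ k)) := by
      rw [hMr]
      field_simp
      ring
    rw [h2]
    have h3 : (0 : ℝ) ≤ m := m.cast_nonneg
    gcongr
    linarith

end Hilbert

theorem frobeniusLipschitz_comp {L : ℝ≥0} {B a : ℝ} {n d : ℕ}
    {ψ : EuclideanSpace ℝ (Fin n) → ℝ} (hψ : ψ ∈ lipschitzClass L B a n)
    {W : Matrix (Fin n) (Fin d) ℝ} (hW : ‖W‖ ≤ B) :
    FrobeniusLipschitz (L * B)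
      fun y : EuclideanSpace ℝ (Fin d) => ψ (Matrix.toEuclideanLin W y) - a := by
  have hball : ∀ y : EuclideanSpace ℝ (Fin d), ‖y‖ ≤ 1 →
      Matrix.toEuclideanLin W y ∈ closedBall (0 : EuclideanSpace ℝ (Fin n)) B := fun y hy =>
    mem_closedBall_of_mem_linearClass (g := fun x => Matrix.toEuclideanLin W x.1)
      ⟨W, hW, rfl⟩ ⟨y, mem_closedBall_zero_iff.2 hy⟩
  -- The controlling linear map is `L • W`.
  refine ⟨by simp [hψ.2], n, fun j => (L : ℝ) • WithLp.toLp 2 (W j), ?_, fun y z hy hz => ?_⟩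
  · have h : ‖W‖ ^ 2 = ∑ i, ∑ j, W i j ^ 2 := by
      rw [Matrix.frobenius_norm_def, ← Real.sqrt_eq_rpow, Real.sq_sqrt (by positivity)]
      simp
    simp only [norm_smul, mul_pow, ← Finset.mul_sum, EuclideanSpace.norm_sq_eq,
      Real.norm_eq_abs, sq_abs, ← h]
    gcongr
  · have h1 := hψ.1.dist_le_mul _ (hball y hy) _ (hball z hz)
    rw [Real.dist_eq, dist_eq_norm, ← map_sub] at h1
    calc _ = |ψ (Matrix.toEuclideanLin W y) - ψ (Matrix.toEuclideanLin W z)| ^ 2 := by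
          rw [sq_abs]
          ring
      _ ≤ (L * ‖Matrix.toEuclideanLin W (y - z)‖) ^ 2 := pow_le_pow_left₀ (abs_nonneg _) h1 2
      _ = _ := by
          rw [mul_pow, EuclideanSpace.norm_sq_eq, Finset.mul_sum]
          refine Finset.sum_congr rfl fun j _ => ?_
          rw [inner_smul_left, mul_pow, Real.norm_eq_abs, sq_abs]
          simp [Matrix.toEuclideanLin, Matrix.mulVec, dotProduct, PiLp.inner_apply, mul_comm,
            mul_sub]

theorem mainTheorem1 :
    ∃ c : ℝ, 0 < c ∧
      ∀ (L : ℝ≥0) (B ε a : ℝ) (n d m : ℕ),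
        1 ≤ L → 1 ≤ B → 0 < ε → ε ≤ 1 → 1 ≤ L * B / ε → 3 ≤ m →
        (L * B / ε) ^ (c * (L : ℝ) ^ 2 * B ^ 2 / ε ^ 2) ≤ (m : ℝ) →
        rademacherComplexity (compositionClass (lipschitzClass L B a n) (linearClass B n d)) m
          ≤ (ε : EReal) := by
  refine ⟨5100, by norm_num, fun L B ε a n d m _ _ hε _ hr hm hmr => ?_⟩
  refine rademacherComplexity_le_of_dominated fun x => ?_
  have hexp : 5100 * (L : ℝ) ^ 2 * B ^ 2 / ε ^ 2 = 5100 * (L * B / ε) ^ 2 := by ring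
  rw [hexp] at hmr
  obtain ⟨b, hb, hs⟩ := exists_dominating_of_sample_size hε hr hm hmr
    (x := fun i => (x i : EuclideanSpace ℝ (Fin d))) fun i => mem_closedBall_zero_iff.1 (x i).2
  have hm0 : (0 : ℝ) < m := by exact_mod_cast (by omega : 0 < m)
  -- The term with `a` restores the subtracted constant and has mean zero over `σ`.
  refine ⟨fun σ => 1 / m * (b σ + a * ∑ i, ((σ i : ℤ) : ℝ)), ?_, ?_⟩
  · rintro σ f ⟨ψ, hψ, g, ⟨W, hW, rfl⟩, rfl⟩
    refine mul_le_mul_of_nonneg_left ?_ (by positivity)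
    have h := hb σ _ (frobeniusLipschitz_comp hψ hW)
    simp only [mul_sub, Finset.sum_sub_distrib, ← Finset.sum_mul] at h
    simp only [Function.comp_apply]
    linarith
  · rw [← Finset.mul_sum, Finset.sum_add_distrib, ← Finset.mul_sum, Finset.sum_comm]
    simp only [sum_sign, Finset.sum_const_zero, mul_zero, add_zero]
    rw [one_div, inv_mul_le_iff₀ hm0]
    linarith
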